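/- Let $M$ be a compact $2$-point-homogeneous space: a compact metric space $(M,\rho)$ on which a group $G$ acts by isometries such that whenever $\rho(x,y)=\rho(x',y')$ there is $g\in G$ with $gx=x'$ and $gy=y'$. Let $\mu$ be the $G$-invariant Borel probability measure on $M$, let $\tau(x,y)=F(\rho(x,y))$ for a function $F:\mathbb R\to\mathbb R$, and put $\tau_0=\tau(x,x)=F(0)$. Let $$L^2(M,\mu)=\widehat{\bigoplus_{0\le k<N}}\;V_k,\qquad N\in\mathbb N\cup\{\infty\},$$ be a decomposition into pairwise orthogonal irreducible $G$-invariant spaces of continuous complex-valued functions, each finite-dimensional, where $V_0$ is the space of constants. Let $\Phi_k:\mathbb R\to\mathbb R$ ($0\le k<N$) be the corresponding zonal spherical functions in the variable $\tau$; that is, for every $y\in M$ the function $x\mapsto\Phi_k(\tau(x,y))$ belongs to $V_k$, and $\Phi_k(\tau_0)=1$. (Here $N=\infty$ when $M$ is infinite, whereas a finite $M$ has only finitely many zonal spherical functions.) For finite subsets $X,Y\subset M$ put $$F_k(X,Y)=\sum_{x\in X,\;y\in Y}\Phi_k(\tau(x,y)).$$ Then for all finite subsets $X_1,\dots,X_d$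 of $M$ and every integer $k$ with $0\le k<N$, the real symmetric $d\times d$ matrix $\bigl(F_k(X_i,X_j)\bigr)_{i,j=1}^d$ is positive semidefinite. -/

import Mathlib

open MeasureTheory

/-- A metric space `M` with an action of a group `G` is 2-point-homogeneous if the distance is
strongly invariant under `G`: the elements of `G` act as isometries, and any two pairs of points
at the same distance are equivalent under `G`. -/
class TwoPointHomogeneousSpace (G M : Type*) [Group G] [MetricSpace M] [MulAction G M] : Prop
    extends IsIsometricSMul G M where
  exists_smul_eq : ∀ x y x' y' : M, dist x y = dist x' y' →
    ∃ g : G, g • x = x' ∧ g • y = y'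

/-- A space of continuous functions on `M` is `G`-invariant if it is stable under
all the substitutions `f ↦ (x ↦ f (g • x))`. -/
def IsInvariantSpace (G : Type*) {M : Type*} [Group G] [MetricSpace M] [MulAction G M]
    [TwoPointHomogeneousSpace G M] (V : Submodule ℂ C(M, ℂ)) : Prop :=
  ∀ g : G, ∀ f ∈ V, f.comp ⟨fun x : M => g • x, continuous_const_smul g⟩ ∈ V

/-- A (finite-dimensional) irreducible `G`-invariant space of continuous functions on `M`. For
compact `M` every closed irreducible `G`-invariant subspace of `L²(M)` is finite-dimensional and
consists of (classes of) continuous functions. -/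
structure IsIrreducibleSpace (G : Type*) {M : Type*} [Group G] [MetricSpace M] [MulAction G M]
    [TwoPointHomogeneousSpace G M] (V : Submodule ℂ C(M, ℂ)) : Prop where
  finiteDimensional : FiniteDimensional ℂ V
  invariant : IsInvariantSpace G V
  ne_bot : V ≠ ⊥
  eq_bot_or_eq : ∀ W : Submodule ℂ C(M, ℂ), W ≤ V → IsInvariantSpace G W → W = ⊥ ∨ W = V

/-- `L²(M, μ)` is the orthogonal Hilbert sum of the irreducible `G`-invariant spaces `V k`, where
`k` runs through the natural numbers `k < N` (all of them if `N = ⊤`, as is the case for infinite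
`M`), and `V 0` is the space of constants. -/
structure IsHarmonicDecomposition (G : Type*) {M : Type*} [Group G] [MetricSpace M]
    [MulAction G M] [TwoPointHomogeneousSpace G M] [CompactSpace M] [MeasurableSpace M]
    [BorelSpace M] (μ : Measure M) [IsFiniteMeasure μ]
    (N : ℕ∞) (V : ℕ → Submodule ℂ C(M, ℂ)) : Prop where
  zero : V 0 = Submodule.span ℂ {(1 : C(M, ℂ))}
  irreducible : ∀ k : ℕ, (k : ℕ∞) < N → IsIrreducibleSpace G (V k)
  orthogonal : ∀ j k : ℕ, (j : ℕ∞) < N → (k : ℕ∞) < N → j ≠ k →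
    ∀ f ∈ V j, ∀ h ∈ V k, ∫ x, f x * starRingEnd ℂ (h x) ∂μ = 0
  dense : ((⨆ (k : ℕ) (_ : (k : ℕ∞) < N), V k).map
    (ContinuousMap.toLp (E := ℂ) 2 μ ℂ).toLinearMap).topologicalClosure = ⊤

/-- With `τ(x, y) = F (dist x y)`, the function `φ` is the zonal spherical function of the
irreducible space `V`: for every point `y` the function `x ↦ φ (τ(x, y))`, which depends only on
the distance to the pole `y`, belongs to `V`, and `φ` is normalized by `φ (τ₀) = 1`, where
`τ₀ = τ(x, x) = F 0`. (These conditions determine `φ` on the set of values of `τ`.) -/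
structure IsZonalFunctionOf {M : Type*} [MetricSpace M] (F : ℝ → ℝ)
    (V : Submodule ℂ C(M, ℂ)) (φ : ℝ → ℝ) : Prop where
  mem : ∀ y : M, ∃ f ∈ V, ∀ x : M, f x = (φ (F (dist x y)) : ℂ)
  normalized : φ (F 0) = 1

/-- `Φ k`, `k < N`, are the zonal spherical functions of the compact 2-point-homogeneous space
`M`, in the variable `τ = F ∘ dist`: they belong to the irreducible summands of `L²(M, μ)`. -/
def IsZonalSystem (G : Type*) {M : Type*} [Group G] [MetricSpace M]
    [MulAction G M] [TwoPointHomogeneousSpace G M] [CompactSpace M] [MeasurableSpace M]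
    [BorelSpace M] (μ : Measure M) [IsFiniteMeasure μ]
    (F : ℝ → ℝ) (N : ℕ∞) (Φ : ℕ → ℝ → ℝ) : Prop :=
  ∃ V : ℕ → Submodule ℂ C(M, ℂ), IsHarmonicDecomposition G μ N V ∧
    ∀ k : ℕ, (k : ℕ∞) < N → IsZonalFunctionOf F (V k) (Φ k)

/-- The sum of `φ (τ(x, y))` over `x ∈ X`, `y ∈ Y`, where `τ(x, y) = F (dist x y)`. -/
noncomputable def zonalSum {M : Type*} [MetricSpace M] (F : ℝ → ℝ) (φ : ℝ → ℝ)
    (X Y : Finset M) : ℝ :=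
  ∑ x ∈ X, ∑ y ∈ Y, φ (F (dist x y))

/-! The kernel `φ (F (dist x y))` is, up to a positive factor, its own convolution square. Indeed it
defines an integral operator on the irreducible space `V` that commutes with `G`, hence a scalar by
Schur's lemma; applying it to the zonal functions themselves gives the identity. Therefore a
positive multiple of the matrix of the theorem is the Gram matrix in L² of the functions `y ↦ ∑ x ∈
X i, φ (F (dist x y))`. -/

theorem Module.Dual.span_range_eq_top_of_separating {K E ι : Type*} [Field K] [AddCommGroup E]
    [Module K E] [FiniteDimensional K E] {l : ι → Module.Dual K E}
    (hl : ∀ v, (∀ i, l i v = 0) → v = 0) : Submodule.span K (Set.range l) = ⊤ := by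
  have h : (Submodule.span K (Set.range l)).dualCoannihilator = ⊥ := by
    rw [eq_bot_iff]
    intro v hv
    rw [Submodule.mem_dualCoannihilator] at hv
    exact hl v fun i => hv _ (Submodule.subset_span ⟨i, rfl⟩)
  exact Subspace.dualCoannihilator_dualAnnihilator_eq.symm.trans
    (h ▸ Submodule.dualAnnihilator_bot)

section EvaluationFunctionals

variable {M : Type*} [TopologicalSpace M] {V : Submodule ℂ C(M, ℂ)}

/-- Point evaluation as a linear functional on a space of continuous functions. -/
noncomputable def evalFunctional (V : Submodule ℂ C(M, ℂ)) (x : M) : Module.Dual ℂ V where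
  toFun f := (f : C(M, ℂ)) x
  map_add' _ _ := rfl
  map_smul' _ _ := rfl

@[simp]
theorem evalFunctional_apply (x : M) (f : V) : evalFunctional V x f = (f : C(M, ℂ)) x := rfl

theorem span_range_evalFunctional [FiniteDimensional ℂ V] :
    Submodule.span ℂ (Set.range (evalFunctional V)) = ⊤ :=
  Module.Dual.span_range_eq_top_of_separating (K := ℂ) (E := V) (l := evalFunctional V) fun f hf => by
    ext x
    exact hf x

/-- Point evaluations span the dual of `V`, so pointwise continuity of a family passes to its
coordinates in any basis. -/
theorem continuous_dual_apply_of_pointwise [FiniteDimensional ℂ V] {Y : Type*}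
    [TopologicalSpace Y] {z : Y → V} (hz : ∀ x, Continuous fun y => (z y : C(M, ℂ)) x)
    (l : Module.Dual ℂ V) : Continuous fun y => l (z y) := by
  have hl : l ∈ Submodule.span ℂ (Set.range (evalFunctional V)) := by
    rw [span_range_evalFunctional]; trivial
  induction hl using Submodule.span_induction with
  | mem l h => obtain ⟨x, rfl⟩ := h; exact hz x
  | zero => exact continuous_const
  | add l₁ l₂ _ _ h₁ h₂ => exact h₁.add h₂
  | smul a l _ h => exact h.const_smul a

end EvaluationFunctionals

section IntegralOperator

variable {M : Type*} [TopologicalSpace M] [CompactSpace M] [MeasurableSpace M]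
  [OpensMeasurableSpace M] {μ : Measure M} [IsFiniteMeasure μ]

theorem Continuous.integrable_of_compactSpace {E : Type*} [NormedAddCommGroup E]
    [SecondCountableTopologyEither M E] {f : M → E} (hf : Continuous f) : Integrable f μ :=
  hf.integrable_of_hasCompactSupport (HasCompactSupport.of_compactSpace f)

/-- A family of functions in a finite-dimensional space `V` is the kernel of an integral operator
on `V`. -/
theorem exists_integralOperator (V : Submodule ℂ C(M, ℂ)) [FiniteDimensional ℂ V] {z : M → V}
    (hz : ∀ x, Continuous fun y => (z y : C(M, ℂ)) x) :
    ∃ A : Module.End ℂ V, ∀ f x,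
      (A f : C(M, ℂ)) x = ∫ y, (z y : C(M, ℂ)) x * (f : C(M, ℂ)) y ∂μ := by
  let b := Module.finBasis ℂ V
  have hc (i) : Continuous fun y => b.coord i (z y) := continuous_dual_apply_of_pointwise hz _
  have hint (i) (f : C(M, ℂ)) : Integrable (fun y => b.coord i (z y) * f y) μ :=
    ((hc i).mul f.continuous).integrable_of_compactSpace
  let l (i) : Module.Dual ℂ V :=
    { toFun := fun f => ∫ y, b.coord i (z y) * (f : C(M, ℂ)) y ∂μ
      map_add' := fun f h => by
        rw [← integral_add (hint i f) (hint i h)]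
        simp [mul_add]
      map_smul' := fun a f => by
        rw [RingHom.id_apply, smul_eq_mul, ← integral_const_mul]
        simp [mul_left_comm] }
  -- The `V`-valued integral of `f y • z y`, taken coordinatewise so that it visibly lies in `V`.
  refine ⟨∑ i, (l i).smulRight (b i), fun f x => ?_⟩
  have hsum (v : V) : (v : C(M, ℂ)) x = ∑ i, b.coord i v * (b i : C(M, ℂ)) x := by
    conv_lhs => rw [← evalFunctional_apply, ← b.sum_repr v, map_sum]
    simp
  calc
    _ = ∑ i, l i f * (b i : C(M, ℂ)) x := by
      rw [← evalFunctional_apply, LinearMap.sum_apply, map_sum]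
      simp
    _ = ∑ i, ∫ y, b.coord i (z y) * (f : C(M, ℂ)) y * (b i : C(M, ℂ)) x ∂μ :=
      Finset.sum_congr rfl fun i _ => (integral_mul_const _ _).symm
    _ = ∫ y, ∑ i, b.coord i (z y) * (f : C(M, ℂ)) y * (b i : C(M, ℂ)) x ∂μ :=
      (integral_finsetSum _ fun i _ => (hint i f).mul_const _).symm
    _ = _ := by
      congr 1 with y
      rw [hsum (z y), Finset.sum_mul]
      exact Finset.sum_congr rfl fun i _ => by ring

end IntegralOperator

/-- Neither `F` nor `φ` is assumed continuous; continuity comes from membership in `V`, with the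
pole moved to `x` by symmetry of `dist`. -/
theorem IsZonalFunctionOf.continuous_right {M : Type*} [MetricSpace M] {V : Submodule ℂ C(M, ℂ)}
    {F φ : ℝ → ℝ} (hφ : IsZonalFunctionOf F V φ) (x : M) :
    Continuous fun y => φ (F (dist x y)) := by
  obtain ⟨f, -, hf⟩ := hφ.mem x
  have h : (fun y => φ (F (dist x y))) = fun y => (f y).re := by
    ext y
    rw [hf, Complex.ofReal_re, dist_comm]
  rw [h]
  fun_prop

section TwoPointHomogeneous

variable {G M : Type*} [Group G] [MetricSpace M] [MulAction G M] [TwoPointHomogeneousSpace G M]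

variable (G M) in
theorem TwoPointHomogeneousSpace.isPretransitive : MulAction.IsPretransitive G M where
  exists_smul_eq x x' :=
    let ⟨g, hg, _⟩ := TwoPointHomogeneousSpace.exists_smul_eq (G := G) x x x' x' (by simp)
    ⟨g, hg⟩

variable [CompactSpace M] [MeasurableSpace M] [BorelSpace M] {μ : Measure M}

variable (G μ) in
omit [BorelSpace M] in
-- By transitivity and compactness, finitely many translates of a nonempty open set, all of equal
-- measure, cover `M`.
theorem TwoPointHomogeneousSpace.isOpenPosMeasure [IsProbabilityMeasure μ]
    [SMulInvariantMeasure G M μ] : μ.IsOpenPosMeasure where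
  open_pos U hU hne := by
    have := TwoPointHomogeneousSpace.isPretransitive G M
    exact (measure_isOpen_pos_of_smulInvariant_of_compact_ne_zero G isCompact_univ
      (by simp) hU hne).ne'

/-- An integral operator on an irreducible space whose kernel is a function of the distance is
a scalar. -/
theorem IsIrreducibleSpace.exists_integral_eq_mul [IsFiniteMeasure μ] [SMulInvariantMeasure G M μ]
    {V : Submodule ℂ C(M, ℂ)} (hV : IsIrreducibleSpace G V) {κ : ℝ → ℂ}
    (hκ : ∀ y : M, ∃ f ∈ V, ∀ x, f x = κ (dist x y)) :
    ∃ c : ℂ, ∀ f ∈ V, ∀ x, ∫ y, κ (dist x y) * f y ∂μ = c * f x := by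
  have := hV.finiteDimensional
  have : Nontrivial V := Submodule.nontrivial_iff_ne_bot.mpr hV.ne_bot
  choose z hzV hz using hκ
  obtain ⟨A, hA⟩ := exists_integralOperator (μ := μ) V (z := fun y => ⟨z y, hzV y⟩) fun x => by
    have h : (fun y => z y x) = z x := by
      ext y
      rw [hz, hz, dist_comm]
    simpa only [h] using (z x).continuous
  simp only [hz] at hA
  -- Schur's lemma: an eigenvalue exists over `ℂ`, and its eigenspace is `G`-invariant because
  -- `dist` and `μ` are, so it is all of `V`.
  obtain ⟨c, hc⟩ := Module.End.exists_eigenvalue A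
  have hmem (f : V) : f ∈ A.eigenspace c ↔
      ∀ x, ∫ y, κ (dist x y) * (f : C(M, ℂ)) y ∂μ = c * (f : C(M, ℂ)) x := by
    rw [Module.End.mem_eigenspace_iff, Subtype.ext_iff, ContinuousMap.ext_iff]
    simp [hA]
  refine ⟨c, fun f hf => (hmem ⟨f, hf⟩).mp ?_⟩
  have hinv : IsInvariantSpace G ((A.eigenspace c).map V.subtype) := by
    rintro g _ ⟨h, hh, rfl⟩
    refine ⟨⟨_, hV.invariant g h h.2⟩, (hmem _).mpr fun x => ?_, rfl⟩
    rw [SetLike.mem_coe, hmem] at hh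
    simp only [ContinuousMap.comp_apply, ContinuousMap.coe_mk]
    rw [← hh (g • x),
      ← integral_smul_eq_self (fun y => κ (dist (g • x) y) * (h : C(M, ℂ)) y) (g := g)]
    simp only [dist_smul]
  have htop := (hV.eq_bot_or_eq _ (Submodule.map_subtype_le V _) hinv).resolve_left fun h =>
    hc (Submodule.map_injective_of_injective V.injective_subtype
      (h.trans (Submodule.map_bot _).symm))
  rw [← htop] at hf
  obtain ⟨h, hh, rfl⟩ := hf
  exact hh

/-- A zonal function is idempotent under convolution, up to a positive factor. -/
theorem IsZonalFunctionOf.exists_integral_mul_eq (G : Type*) [Group G] [MulAction G M]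
    [TwoPointHomogeneousSpace G M] [IsProbabilityMeasure μ] [SMulInvariantMeasure G M μ]
    {V : Submodule ℂ C(M, ℂ)} (hV : IsIrreducibleSpace G V) {F φ : ℝ → ℝ}
    (hφ : IsZonalFunctionOf F V φ) :
    ∃ c : ℝ, 0 < c ∧ ∀ x w : M,
      ∫ y, φ (F (dist x y)) * φ (F (dist w y)) ∂μ = c * φ (F (dist x w)) := by
  obtain ⟨c, hc⟩ := hV.exists_integral_eq_mul (μ := μ) (κ := fun r => (φ (F r) : ℂ)) hφ.mem
  have key (x w : M) :
      ((∫ y, φ (F (dist x y)) * φ (F (dist w y)) ∂μ : ℝ) : ℂ) = c * φ (F (dist x w)) := by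
    obtain ⟨f, hf, hfx⟩ := hφ.mem w
    rw [← hfx x, ← hc f hf x, ← integral_complex_ofReal]
    simp [hfx, dist_comm w]
  obtain ⟨p⟩ : Nonempty M := nonempty_of_isProbabilityMeasure μ
  -- On the diagonal the scalar equals the integral of a square, so it is real; it is positive
  -- because the continuous integrand is 1 at `p`.
  have hp := key p p
  rw [dist_self, hφ.normalized, Complex.ofReal_one, mul_one] at hp
  refine ⟨_, ?_, fun x w => by exact_mod_cast (hp ▸ key x w)⟩
  have := TwoPointHomogeneousSpace.isOpenPosMeasure G μ
  have hcont := hφ.continuous_right p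
  refine (hcont.mul hcont).integral_pos_of_hasCompactSupport_nonneg_nonzero
    (HasCompactSupport.of_compactSpace _) (fun y => mul_self_nonneg _) (x := p) ?_
  simp [hφ.normalized]

end TwoPointHomogeneous

theorem theorem7p1 {G M : Type*} [Group G] [MetricSpace M] [MulAction G M]
    [TwoPointHomogeneousSpace G M] [CompactSpace M] [MeasurableSpace M] [BorelSpace M]
    (μ : Measure M) [IsProbabilityMeasure μ] [SMulInvariantMeasure G M μ]
    (F : ℝ → ℝ) (N : ℕ∞) (Φ : ℕ → ℝ → ℝ) (hΦ : IsZonalSystem G μ F N Φ)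
    {d : ℕ} (X : Fin d → Finset M) (k : ℕ) (hk : (k : ℕ∞) < N) :
    (Matrix.of fun i j : Fin d => zonalSum F (Φ k) (X i) (X j)).PosSemidef := by
  obtain ⟨V, hV, hΦ⟩ := hΦ
  obtain ⟨c, hc, h⟩ :=
    (hΦ k hk).exists_integral_mul_eq G (μ := μ) (hV.irreducible k hk)
  let u (i : Fin d) (y : M) : ℝ := ∑ x ∈ X i, Φ k (F (dist x y))
  have hu (i) : Continuous (u i) :=
    continuous_finsetSum _ fun x _ => (hΦ k hk).continuous_right x
  have hint (i j : Fin d) : c * zonalSum F (Φ k) (X i) (X j) = ∫ y, u i y * u j y ∂μ := by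
    have hK (x w : M) : Integrable (fun y => Φ k (F (dist x y)) * Φ k (F (dist w y))) μ :=
      (((hΦ k hk).continuous_right x).mul
        ((hΦ k hk).continuous_right w)).integrable_of_compactSpace
    simp only [u, Finset.sum_mul_sum]
    rw [integral_finsetSum _ fun x _ => integrable_finsetSum _ fun w _ => hK x w]
    simp only [integral_finsetSum _ fun w _ => hK _ w, h, zonalSum, Finset.mul_sum]
  refine .of_dotProduct_mulVec_nonneg ?_ fun a => ?_
  · ext i j
    simp only [Matrix.conjTranspose_apply, Matrix.of_apply, star_trivial, zonalSum]
    rw [Finset.sum_comm]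
    simp only [dist_comm]
  · refine nonneg_of_mul_nonneg_right (a := c) ?_ hc
    -- The quadratic form, scaled by `c`, is the squared L² norm of `∑ i, a i * u i`.
    have hsq : c * (star a ⬝ᵥ (Matrix.of fun i j => zonalSum F (Φ k) (X i) (X j)).mulVec a) =
        ∫ y, (∑ i, a i * u i y) * ∑ i, a i * u i y ∂μ := by
      have hI (i j : Fin d) : Integrable (fun y => a i * u i y * (a j * u j y)) μ :=
        ((continuous_const.mul (hu i)).mul
          (continuous_const.mul (hu j))).integrable_of_compactSpace
      simp only [Finset.sum_mul_sum]
      rw [integral_finsetSum _ fun i _ => integrable_finsetSum _ fun j _ => hI i j]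
      simp only [integral_finsetSum _ fun j _ => hI _ j, dotProduct, Matrix.mulVec,
        Matrix.of_apply, star_trivial, Finset.mul_sum]
      refine Finset.sum_congr rfl fun i _ => Finset.sum_congr rfl fun j _ => ?_
      calc
        _ = a i * a j * (c * zonalSum F (Φ k) (X i) (X j)) := by ring
        _ = _ := by
          rw [hint, ← integral_const_mul]
          congr 1 with y
          ring
    rw [hsq]
    exact integral_nonneg fun y => mul_self_nonneg _
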